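/- **Setting.** Let $(I,\mathbb A,m)$ be a finite measure space and write $|Q|=m(Q)$. A *grid* is a sequence $\mathcal P=(\mathcal P^k)_{k\ge 0}$ of finite families of measurable sets of positive measure, not all empty, no set belonging to two different levels, with $M:=\sup_k\sup_{Q\in\mathcal P^k}\#\{P\in\mathcal P^k: P\cap Q\ne\emptyset\}<\infty$. Put $|\mathcal P^k|=\sup_{Q\in\mathcal P^k}|Q|$. For $0<\lambda_1<\lambda_2<1$ the grid is a $(\lambda_1,\lambda_2)$-*good grid* if $\mathcal P^0=\{I\}$; each $\mathcal P^k$ covers $I$ up to a null set and consists of pairwise disjoint sets; every $Q\in\mathcal P^{k+1}$ is contained in some $P\in\mathcal P^k$; $\lambda_1\le |Q|/|P|\le\lambda_2$ whenever $Q\in\mathcal P^{k+1}$, $P\in\mathcal P^k$, $Q\subset P$; and $\bigcup_k\mathcal P^k$ generates $\mathbb A$. Fix a $(\lambda_1,\lambda_2)$-good grid. For $s>0$, $p\in[1,\infty)$, an $(s,p)$-*Souza's atom* on $Q$ is a function $a\colon I\to\mathbb C$ that vanishes outside $Q$, is constant on $Q$, and satisfies $|a|_\infty\le|Q|^{s-1/p}$.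 For $q\in[1,\infty]$ the space $\mathcal B^s_{p,q}$ consists of all $f\in L^p(m)$ that have a representation $f=\sum_k\sum_{Q\in\mathcal P^k}c_Qa_Q$ with $c_Q\in\mathbb C$, $a_Q$ an $(s,p)$-Souza's atom on $Q$, absolutely convergent in $L^p$ (that is, $\sum_k|\sum_{Q\in\mathcal P^k}c_Qa_Q|_p<\infty$), and with finite cost $\big(\sum_k(\sum_{Q\in\mathcal P^k}|c_Q|^p)^{q/p}\big)^{1/q}$ (with a supremum over $k$ if $q=\infty$). The norm $|f|_{\mathcal B^s_{p,q}}$ is the infimum of the costs of all such representations of $f$. **Proposition 16.6 (Pointwise multipliers II).** Let $p\in[1,\infty)$, $q\in[1,\infty]$, $0<s<1/p$, and let $g\in\mathcal B^{1/p}_{p,\infty}\cap L^\infty$. Then $G(f)=gf$ is a well defined and bounded operator $G\colon\mathcal B^s_{p,q}\to\mathcal B^s_{p,q}$, and $$|G|_{\mathcal B^s_{p,q}}=\sup\{|gf|_{\mathcal B^s_{p,q}}: |f|_{\mathcal B^s_{p,q}}\le 1\}\le C_e\,C_{no}\,\frac{|g|_{\mathcal B^{1/p}_{p,\infty}}}{1-\lambda_2^{1/p-s}}+|g|_\infty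 ,$$ and indeed $|gf|_{\mathcal B^s_{p,q}}$ is at most the right-hand side times $|f|_{\mathcal B^s_{p,q}}$ for every $f\in\mathcal B^s_{p,q}$. Here the constants, which do not depend on $s$, $q$ or $g$, are $$C_e=1+\Big(\frac{\lambda_2^{1/2}}{\sqrt2\,\lambda_1^{3/2}}+1\Big)\lambda_1^{-2-1/p},\qquad C_{no}=M^{1+1/p}\Big(\sum_{k\ge0}|\mathcal P^k|^{1/p}\Big)|I|^{-1/p}+\frac1{1-\lambda_2^{1/p}} .$$ -/

import Mathlib

open MeasureTheory Filter Topology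
open scoped ENNReal

noncomputable section

/-- A grid on the measure space `(I, μ)`: a sequence of finite families of measurable sets of
positive measure, not all of them empty, no set occurring at two different levels, such that the
number of sets of a level that meet a given set of the same level is bounded. -/
structure Grid {I : Type*} [MeasurableSpace I] (μ : Measure I) where
  /-- the `k`-th family -/
  cells : ℕ → Finset (Set I)
  measurable_cells : ∀ k, ∀ Q ∈ cells k, MeasurableSet Q
  measure_pos : ∀ k, ∀ Q ∈ cells k, 0 < μ Q
  exists_nonempty : ∃ k, (cells k).Nonempty
  level_ne : ∀ i j, i ≠ j → ∀ P ∈ cells i, ∀ Q ∈ cells j, P ≠ Q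
  bounded_overlap : ∃ N : ℕ, ∀ k, ∀ Q ∈ cells k,
    Set.ncard {P : Set I | P ∈ cells k ∧ (P ∩ Q).Nonempty} ≤ N

namespace Grid

variable {I : Type*} [MeasurableSpace I] {μ : Measure I}

/-- The overlap constant of a grid: the largest number of sets of a level that meet a given set of
that level (the set below is bounded by `bounded_overlap`). -/
def overlap (P : Grid μ) : ℕ :=
  sSup {n : ℕ | ∃ k, ∃ Q ∈ P.cells k,
    n = Set.ncard {R : Set I | R ∈ P.cells k ∧ (R ∩ Q).Nonempty}}

/-- The largest measure of a set of level `k`. -/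
def mesh (P : Grid μ) (k : ℕ) : ℝ :=
  ⨆ Q : P.cells k, μ.real (Q : Set I)

/-- `(l₁, l₂)`-good grids. -/
structure IsGood (P : Grid μ) (l₁ l₂ : ℝ) : Prop where
  pos : 0 < l₁
  lt : l₁ < l₂
  lt_one : l₂ < 1
  zero_level : P.cells 0 = {Set.univ}
  cover : ∀ k, μ (⋃ Q ∈ P.cells k, Q)ᶜ = 0
  disjoint : ∀ k, (P.cells k : Set (Set I)).PairwiseDisjoint id
  nested : ∀ k, ∀ Q ∈ P.cells (k + 1), ∃ R ∈ P.cells k, Q ⊆ R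
  ratio : ∀ k, ∀ Q ∈ P.cells (k + 1), ∀ R ∈ P.cells k, Q ⊆ R →
    l₁ ≤ μ.real Q / μ.real R ∧ μ.real Q / μ.real R ≤ l₂
  generates : MeasurableSpace.generateFrom (⋃ k, (P.cells k : Set (Set I))) = ‹MeasurableSpace I›

/-- The norm of `ℓ_q(ℓ_p^P)`:
`(∑ k, (∑ Q ∈ P^k, |c Q| ^ p) ^ (q / p)) ^ (1 / q)`, with a supremum over `k` if `q = ∞`. -/
def cost (P : Grid μ) (p : ℝ) (q : ℝ≥0∞) (c : Set I → ℂ) : ℝ≥0∞ :=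
  if q = ∞ then ⨆ k, (∑ Q ∈ P.cells k, ‖c Q‖ₑ ^ p) ^ (1 / p)
  else (∑' k, (∑ Q ∈ P.cells k, ‖c Q‖ₑ ^ p) ^ (q.toReal / p)) ^ (1 / q.toReal)

/-- The `k`-th block `∑ Q ∈ P^k, c Q • a Q` of an atomic series. -/
def block (P : Grid μ) (c : Set I → ℂ) (a : Set I → I → ℂ) (k : ℕ) (x : I) : ℂ :=
  ∑ Q ∈ P.cells k, c Q * a Q x

end Grid

/-- `(s, p)`-Souza's atoms supported on `Q`: functions that vanish outside `Q`, are constant on `Q`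
and are bounded by `|Q| ^ (s - 1 / p)`. -/
def IsSouzaAtom {I : Type*} [MeasurableSpace I] (μ : Measure I) (s p : ℝ) (Q : Set I)
    (a : I → ℂ) : Prop :=
  (∀ x, x ∉ Q → a x = 0) ∧ (∃ z : ℂ, ∀ x ∈ Q, a x = z) ∧
    ∀ x, ‖a x‖ ≤ μ.real Q ^ (s - 1 / p)

namespace Grid

variable {I : Type*} [MeasurableSpace I] {μ : Measure I}

/-- For `1 ≤ p < ∞`: `∑ k, ∑ Q ∈ P^k, c Q • a Q` is a representation of `f` in the Besov space
with parameters `s, p, q`: the `a Q` are `(s, p)`-Souza's atoms, the cost is finite, and the series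
of the blocks converges absolutely in `L^p`, with sum `f`. -/
structure IsRepresentation (P : Grid μ) (s p : ℝ) (q : ℝ≥0∞) (f : I → ℂ)
    (c : Set I → ℂ) (a : Set I → I → ℂ) : Prop where
  atoms : ∀ k, ∀ Q ∈ P.cells k, IsSouzaAtom μ s p Q (a Q)
  cost_lt_top : P.cost p q c < ∞
  abs_conv : ∑' k, eLpNorm (P.block c a k) (ENNReal.ofReal p) μ < ∞
  tendsto : Tendsto
    (fun n : ℕ => eLpNorm (fun x => f x - ∑ k ∈ Finset.range n, P.block c a k x)
      (ENNReal.ofReal p) μ) atTop (𝓝 0)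

/-- Membership in the Besov space `B^s_{p,q}` of the grid (for `1 ≤ p < ∞`); it is invariant under
changes of `f` on null sets. -/
def MemBesov (P : Grid μ) (s p : ℝ) (q : ℝ≥0∞) (f : I → ℂ) : Prop :=
  MemLp f (ENNReal.ofReal p) μ ∧ ∃ c a, P.IsRepresentation s p q f c a

/-- The norm of `B^s_{p,q}`: the infimum of the costs of all representations. It is meant for
members of the space, where the infimum is finite. -/
def besovNorm (P : Grid μ) (s p : ℝ) (q : ℝ≥0∞) (f : I → ℂ) : ℝ :=
  (⨅ (c : Set I → ℂ) (a : Set I → I → ℂ) (_ : P.IsRepresentation s p q f c a),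
    P.cost p q c).toReal

/-- The operator norm of the multiplication by `g` on `B^s_{p,q}`: the supremum of
`|g f|` over all `f` in the space with `|f| ≤ 1`. -/
def multiplierNorm (P : Grid μ) (s p : ℝ) (q : ℝ≥0∞) (g : I → ℂ) : ℝ :=
  sSup {r : ℝ | ∃ f : I → ℂ, P.MemBesov s p q f ∧ P.besovNorm s p q f ≤ 1 ∧
    r = P.besovNorm s p q (fun x => g x * f x)}

end Grid

/-- The constant of Hölder's inequality for `1 ≤ t` and `1 ≤ q ≤ ∞`, with `1 / q + 1 / q' = 1`:
`(∑ k, b k ^ (q' / t)) ^ (1 / q')` if `q > 1`, and `sup k, b k ^ (1 / t)` if `q = 1`. -/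
def holderConst (t : ℝ) (q : ℝ≥0∞) (b : ℕ → ℝ) : ℝ :=
  if q = 1 then ⨆ k, b k ^ (1 / t)
  else
    let q' : ℝ := (1 - q⁻¹.toReal)⁻¹
    (∑' k, b k ^ (q' / t)) ^ (1 / q')

/-- The constant that bounds the Haar functions of an `(l₁, l₂)`-good grid:
`l₂ ^ (1 / 2) / (√2 l₁ ^ (3 / 2)) + 1`. -/
def haarConst (l₁ l₂ : ℝ) : ℝ :=
  l₂ ^ (1 / 2 : ℝ) / (√2 * l₁ ^ (3 / 2 : ℝ)) + 1

/-- The constant in the estimate of the standard atomic norm by the Haar norm. -/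
def standardConst (l₁ l₂ s p : ℝ) : ℝ :=
  1 + haarConst l₁ l₂ * max (l₂ ^ (1 / p - s)) (l₁ ^ (1 / p - s)) * l₁ ^ (-2 - 1 / p)

/-- The constant in the estimate of the mean oscillation norm by the Besov norm. For an
`(l₁, l₂)`-good grid the mesh decays geometrically, so the series in it converges. -/
def oscConst {I : Type*} [MeasurableSpace I] {μ : Measure I} (P : Grid μ) (l₂ s p : ℝ)
    (q : ℝ≥0∞) : ℝ :=
  (P.overlap : ℝ) ^ (1 + 1 / p) * holderConst p q (fun k => P.mesh k ^ (s * p)) *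
      μ.real Set.univ ^ (-s) +
    1 / (1 - l₂ ^ s)

end

/-! Write `G n` and `F n` for the partial sums of the atomic series of `g` and `f`. Then `g * f` is
the limit of `G n * F n`, and the increments `G (n + 1) * aₙ + bₙ * F n`, where `aₙ` and `bₙ` are
the `n`-th blocks of `f` and `g`, are constant on the cells of level `n`; so they are combinations
of atoms, and only the cost has to be estimated.

On a cell `R` of level `n`, the value of `G (n + 1)` is at most `‖g‖_∞` plus the `L^p` norm of
`g - G (n + 1)` for the normalized measure of `R`. As atoms of smoothness `1 / p` are bounded by
`1`, the later blocks of `g` contribute to this norm a geometric series of ratio `l₂ ^ (1 / p)`.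

Passing to a cell of the next level multiplies `|R| ^ (1 / p - s)` by at most `l₂ ^ (1 / p - s)`.
So `|R| ^ (1 / p - s) * |F n|` is bounded on `R` by the convolution of the `ℓ^p` norms of the levels
of `f` with a geometric sequence, and Young's inequality bounds its `ℓ^q` norm.
-/

open scoped NNReal

noncomputable section

/-- The convolution `∑ j < k, t ^ (k - j) * b j` of `b` with a geometric sequence. -/
def geometricConv (t : ℝ≥0∞) (b : ℕ → ℝ≥0∞) : ℕ → ℝ≥0∞
  | 0 => 0
  | k + 1 => t * (geometricConv t b k + b k)

section Sequences

variable {ι : Type*} {p : ℝ} {q t : ℝ≥0∞}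

theorem mul_inv_one_sub_add_one (ht : t < 1) : t * (1 - t)⁻¹ + 1 = (1 - t)⁻¹ := by
  calc t * (1 - t)⁻¹ + 1 = (t + (1 - t)) * (1 - t)⁻¹ := by
        rw [add_mul, ENNReal.mul_inv_cancel (tsub_pos_of_lt ht).ne'
          (ENNReal.sub_ne_top ENNReal.one_ne_top)]
    _ = (1 - t)⁻¹ := by rw [add_tsub_cancel_of_le ht.le, one_mul]

theorem inv_one_sub_add_le_mul (r : ℝ≥0∞) (ht : t < 1) :
    (1 - r)⁻¹ + t * (1 - t)⁻¹ ≤ (1 - r)⁻¹ * (1 - t)⁻¹ := by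
  have hr : 1 ≤ (1 - r)⁻¹ := ENNReal.one_le_inv.2 tsub_le_self
  calc (1 - r)⁻¹ + t * (1 - t)⁻¹ ≤ (1 - r)⁻¹ + (1 - r)⁻¹ * (t * (1 - t)⁻¹) := by
        exact add_le_add_right (le_mul_of_one_le_left' hr) _
    _ = (1 - r)⁻¹ * (t * (1 - t)⁻¹ + 1) := by ring
    _ = (1 - r)⁻¹ * (1 - t)⁻¹ := by rw [mul_inv_one_sub_add_one ht]

theorem one_le_toReal_of_ne_top (hq : 1 ≤ q) (h : q ≠ ∞) : 1 ≤ q.toReal := by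
  simpa using ENNReal.toReal_mono h hq

theorem finset_Lp_const_mul (S : Finset ι) (f : ι → ℝ≥0∞) (C : ℝ≥0∞) (hp : 0 < p) :
    (∑ i ∈ S, (C * f i) ^ p) ^ (1 / p) = C * (∑ i ∈ S, f i ^ p) ^ (1 / p) := by
  simp_rw [ENNReal.mul_rpow_of_nonneg _ _ hp.le]
  rw [← Finset.mul_sum, ENNReal.mul_rpow_of_nonneg _ _ (by positivity), ← ENNReal.rpow_mul,
    mul_one_div_cancel hp.ne', ENNReal.rpow_one]

theorem finset_Lp_le_of_le_add (S : Finset ι) {f a b : ι → ℝ≥0∞} {C D : ℝ≥0∞} (hp : 1 ≤ p)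
    (h : ∀ i ∈ S, f i ≤ C * a i + D * b i) :
    (∑ i ∈ S, f i ^ p) ^ (1 / p) ≤
      C * (∑ i ∈ S, a i ^ p) ^ (1 / p) + D * (∑ i ∈ S, b i ^ p) ^ (1 / p) := by
  have hp0 : 0 < p := by linarith
  rw [← finset_Lp_const_mul _ _ _ hp0, ← finset_Lp_const_mul _ _ _ hp0]
  refine le_trans ?_ (ENNReal.Lp_add_le S _ _ hp)
  gcongr with i hi
  exact h i hi

theorem eLpNorm_count_eq_tsum (hq : 1 ≤ q) (h : q ≠ ∞) (b : ℕ → ℝ≥0∞) :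
    eLpNorm b q Measure.count = (∑' k, b k ^ q.toReal) ^ (1 / q.toReal) := by
  simp [eLpNorm_eq_lintegral_rpow_enorm_toReal (zero_lt_one.trans_le hq).ne' h, lintegral_count]

theorem eLpNorm_count_top (b : ℕ → ℝ≥0∞) : eLpNorm b ∞ Measure.count = ⨆ k, b k := by
  simp [eLpNormEssSup_count]

theorem eLpNorm_count_const_mul (hq : 1 ≤ q) (C : ℝ≥0∞) (b : ℕ → ℝ≥0∞) :
    eLpNorm (fun k => C * b k) q Measure.count = C * eLpNorm b q Measure.count := by
  by_cases h : q = ∞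
  · simp_rw [h, eLpNorm_count_top, ENNReal.mul_iSup]
  · have hq0 : 0 < q.toReal := zero_lt_one.trans_le (one_le_toReal_of_ne_top hq h)
    simp_rw [eLpNorm_count_eq_tsum hq h, ENNReal.mul_rpow_of_nonneg _ _ hq0.le,
      ENNReal.tsum_mul_left]
    rw [ENNReal.mul_rpow_of_nonneg _ _ (by positivity), ← ENNReal.rpow_mul,
      mul_one_div_cancel hq0.ne', ENNReal.rpow_one]

theorem geometricConv_le_of_forall_le {b : ℕ → ℝ≥0∞} {B C : ℝ≥0∞} (hC : t * (C + 1) ≤ C)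
    (hb : ∀ k, b k ≤ B) (k : ℕ) : geometricConv t b k ≤ C * B := by
  induction k with
  | zero => simp [geometricConv]
  | succ k ih =>
    calc geometricConv t b (k + 1) ≤ t * (C * B + B) := by
          rw [geometricConv]
          gcongr
          exact hb k
      _ = t * (C + 1) * B := by ring
      _ ≤ C * B := by gcongr

theorem sum_range_geometricConv_rpow_le {b : ℕ → ℝ≥0∞} {C : ℝ≥0∞} (hC : t * (C + 1) ≤ C)
    (hp : 1 ≤ p) (n : ℕ) :
    (∑ k ∈ Finset.range n, geometricConv t b k ^ p) ^ (1 / p) ≤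
      C * (∑ k ∈ Finset.range n, b k ^ p) ^ (1 / p) := by
  have hp0 : 0 < p := by linarith
  have h_mono (n : ℕ) : (∑ k ∈ Finset.range n, b k ^ p) ^ (1 / p) ≤
      (∑ k ∈ Finset.range (n + 1), b k ^ p) ^ (1 / p) := by
    gcongr
    exact n.le_succ
  induction n with
  | zero => simp [hp0]
  | succ n ih =>
    set B := (∑ k ∈ Finset.range (n + 1), b k ^ p) ^ (1 / p)
    calc (∑ k ∈ Finset.range (n + 1), geometricConv t b k ^ p) ^ (1 / p)
        = t * (∑ k ∈ Finset.range n, (geometricConv t b k + b k) ^ p) ^ (1 / p) := by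
          simp_rw [Finset.sum_range_succ' _ n, geometricConv, ENNReal.zero_rpow_of_pos hp0,
            add_zero, finset_Lp_const_mul _ _ _ hp0]
      _ ≤ t * (C * B + B) := by
          gcongr
          exact (ENNReal.Lp_add_le _ _ _ hp).trans
            (add_le_add (ih.trans (by gcongr; exact h_mono n)) (h_mono n))
      _ = t * (C + 1) * B := by ring
      _ ≤ C * B := by gcongr

/-- A discrete form of Young's convolution inequality. -/
theorem eLpNorm_geometricConv_le (hq : 1 ≤ q) (ht : t < 1) (b : ℕ → ℝ≥0∞) :
    eLpNorm (geometricConv t b) q Measure.count ≤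
      t * (1 - t)⁻¹ * eLpNorm b q Measure.count := by
  have hC : t * (t * (1 - t)⁻¹ + 1) ≤ t * (1 - t)⁻¹ := by rw [mul_inv_one_sub_add_one ht]
  by_cases h : q = ∞
  · rw [h, eLpNorm_count_top, eLpNorm_count_top]
    exact iSup_le (geometricConv_le_of_forall_le hC (le_iSup b))
  · have hq' := one_le_toReal_of_ne_top hq h
    have hq0 : 0 < q.toReal := by linarith
    rw [eLpNorm_count_eq_tsum hq h, eLpNorm_count_eq_tsum hq h, one_div,
      ENNReal.rpow_inv_le_iff hq0, ENNReal.tsum_eq_iSup_nat]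
    refine iSup_le fun n => ?_
    rw [← ENNReal.rpow_inv_le_iff hq0, ← one_div]
    refine (sum_range_geometricConv_rpow_le hC hq' n).trans ?_
    gcongr
    exact ENNReal.sum_le_tsum _

end Sequences

theorem eLpNorm_ofReal_eq {α E : Type*} [MeasurableSpace α] [NormedAddCommGroup E] {p : ℝ}
    (hp : 0 < p) (f : α → E) (ν : Measure α) :
    eLpNorm f (ENNReal.ofReal p) ν = (∫⁻ x, ‖f x‖ₑ ^ p ∂ν) ^ (1 / p) := by
  rw [eLpNorm_eq_lintegral_rpow_enorm_toReal (by simpa using hp) ENNReal.ofReal_ne_top,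
    ENNReal.toReal_ofReal hp.le]

theorem setLIntegral_mul_rpow_le {I : Type*} [MeasurableSpace I] {μ : Measure I} {p : ℝ}
    (hp : 0 < p) {R : Set I} (hR : MeasurableSet R) (h_pos : 0 < μ R) (h_fin : μ R ≠ ∞)
    (u : I → ℂ) {F : I → ℂ} {D : ℝ≥0∞} (hD : D ≠ ∞)
    (hF : ∀ x ∈ R, ‖F x‖ₑ * μ R ^ (1 / p) ≤ D) :
    ∫⁻ x in R, ‖u x * F x‖ₑ ^ p ∂μ ≤ D ^ p * ((μ R)⁻¹ * ∫⁻ x in R, ‖u x‖ₑ ^ p ∂μ) := by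
  have h_point (x : I) (hx : x ∈ R) : ‖u x * F x‖ₑ ^ p ≤ D ^ p * (μ R)⁻¹ * ‖u x‖ₑ ^ p := by
    have hFx : ‖F x‖ₑ ≤ D / μ R ^ (1 / p) := by
      rw [ENNReal.le_div_iff_mul_le
        (.inl (ENNReal.rpow_pos h_pos h_fin).ne')
        (.inl (ENNReal.rpow_ne_top_of_nonneg (by positivity) h_fin))]
      exact hF x hx
    calc ‖u x * F x‖ₑ ^ p ≤ (‖u x‖ₑ * (D / μ R ^ (1 / p))) ^ p := by
          rw [enorm_mul]
          gcongr
      _ = D ^ p * (μ R)⁻¹ * ‖u x‖ₑ ^ p := by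
          rw [div_eq_mul_inv, ENNReal.mul_rpow_of_nonneg _ _ hp.le,
            ENNReal.mul_rpow_of_nonneg _ _ hp.le, ENNReal.inv_rpow, ← ENNReal.rpow_mul,
            one_div_mul_cancel hp.ne', ENNReal.rpow_one, mul_comm]
  rw [← mul_assoc, ← lintegral_const_mul' _ _ (ENNReal.mul_ne_top
    (ENNReal.rpow_ne_top_of_nonneg hp.le hD) (ENNReal.inv_ne_top.2 h_pos.ne'))]
  exact setLIntegral_mono' hR h_point

section Atoms

variable {I : Type*} [MeasurableSpace I] {μ : Measure I} {s p : ℝ} {Q : Set I} {a : I → ℂ}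

theorem IsSouzaAtom.eq_indicator (ha : IsSouzaAtom μ s p Q a) :
    ∃ z, a = Q.indicator fun _ => z := by
  obtain ⟨h_zero, ⟨z, hz⟩, -⟩ := ha
  refine ⟨z, funext fun x => ?_⟩
  by_cases hx : x ∈ Q
  · rw [hz x hx, Set.indicator_of_mem hx]
  · rw [h_zero x hx, Set.indicator_of_notMem hx]

theorem IsSouzaAtom.stronglyMeasurable (ha : IsSouzaAtom μ s p Q a) (hQ : MeasurableSet Q) :
    StronglyMeasurable a := by
  obtain ⟨z, rfl⟩ := ha.eq_indicator
  exact stronglyMeasurable_const.indicator hQ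

theorem ofReal_measureReal_rpow (h_pos : 0 < μ Q) (h_fin : μ Q ≠ ∞) (r : ℝ) :
    ENNReal.ofReal (μ.real Q ^ r) = μ Q ^ r := by
  have h_real : 0 < μ.real Q := ENNReal.toReal_pos h_pos.ne' h_fin
  rw [← ENNReal.ofReal_rpow_of_pos h_real, ofReal_measureReal h_fin]

theorem IsSouzaAtom.enorm_le (ha : IsSouzaAtom μ s p Q a) (h_pos : 0 < μ Q) (h_fin : μ Q ≠ ∞)
    (x : I) : ‖a x‖ₑ ≤ μ Q ^ (s - 1 / p) := by
  rw [← ofReal_measureReal_rpow h_pos h_fin, ← ofReal_norm]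
  exact ENNReal.ofReal_le_ofReal (ha.2.2 x)

theorem isSouzaAtom_indicator_rpow (s p : ℝ) (Q : Set I) :
    IsSouzaAtom μ s p Q (Q.indicator fun _ => ((μ.real Q ^ (s - 1 / p) : ℝ) : ℂ)) := by
  refine ⟨fun x hx => Set.indicator_of_notMem hx _,
    ⟨_, fun x hx => Set.indicator_of_mem hx _⟩, fun x => ?_⟩
  refine (norm_indicator_le_norm_self _ x).trans_eq ?_
  rw [Complex.norm_real, Real.norm_of_nonneg (Real.rpow_nonneg measureReal_nonneg _)]

end Atoms

namespace Grid

section Basic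

variable {I : Type*} [MeasurableSpace I] {μ : Measure I} {P : Grid μ} {s p : ℝ} {q : ℝ≥0∞}
  {c : Set I → ℂ} {a : Set I → I → ℂ} {k : ℕ}

/-- The `ℓ^p` norm of the coefficients of level `k`. -/
def levelNorm (P : Grid μ) (p : ℝ) (c : Set I → ℂ) (k : ℕ) : ℝ≥0∞ :=
  (∑ Q ∈ P.cells k, ‖c Q‖ₑ ^ p) ^ (1 / p)

/-- The sum of the normalized restrictions of `μ` to the cells of level `k`, each of which
becomes a probability measure. -/
def levelMeasure (P : Grid μ) (k : ℕ) : Measure I :=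
  ∑ R ∈ P.cells k, ProbabilityTheory.cond μ R

/-- The partial sum `∑ k < n, ∑ Q ∈ P^k, c Q • a Q` of an atomic series. -/
def partialSum (P : Grid μ) (c : Set I → ℂ) (a : Set I → I → ℂ) (n : ℕ) (x : I) : ℂ :=
  ∑ k ∈ Finset.range n, P.block c a k x

/-- Functions that are constant on each cell of level `k`. -/
def IsStep (P : Grid μ) (k : ℕ) (h : I → ℂ) : Prop :=
  ∀ R ∈ P.cells k, ∀ x ∈ R, ∀ y ∈ R, h x = h y

/-- The norm of `B^s_{p,q}` before truncation to a real number: it is infinite for functions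
without a representation. -/
def besovENorm (P : Grid μ) (s p : ℝ) (q : ℝ≥0∞) (f : I → ℂ) : ℝ≥0∞ :=
  ⨅ (c : Set I → ℂ) (a : Set I → I → ℂ) (_ : P.IsRepresentation s p q f c a), P.cost p q c

theorem IsRepresentation.besovENorm_le_cost {f : I → ℂ} (hf : P.IsRepresentation s p q f c a) :
    P.besovENorm s p q f ≤ P.cost p q c :=
  iInf₂_le_of_le c a (iInf_le _ hf)

theorem MemBesov.besovENorm_ne_top {f : I → ℂ} (hf : P.MemBesov s p q f) :
    P.besovENorm s p q f ≠ ∞ := by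
  obtain ⟨-, c, a, h⟩ := hf
  exact (h.besovENorm_le_cost.trans_lt h.cost_lt_top).ne

theorem MemBesov.le_map_besovENorm {f : I → ℂ} (hf : P.MemBesov s p q f) {z : ℝ≥0∞}
    {φ : ℝ≥0∞ → ℝ≥0∞} (hφ : Continuous φ) (hφ_mono : Monotone φ)
    (h : ∀ c a, P.IsRepresentation s p q f c a → z ≤ φ (P.cost p q c)) :
    z ≤ φ (P.besovENorm s p q f) := by
  have h_gt (y : ℝ≥0∞) (hy : P.besovENorm s p q f < y) : z ≤ φ y := by
    simp only [besovENorm, iInf_lt_iff] at hy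
    obtain ⟨c, a, hca, h_lt⟩ := hy
    exact (h c a hca).trans (hφ_mono h_lt.le)
  have := nhdsGT_neBot_of_exists_gt ⟨∞, hf.besovENorm_ne_top.lt_top⟩
  exact ge_of_tendsto (hφ.continuousWithinAt (s := Set.Ioi (P.besovENorm s p q f)))
    (eventually_mem_nhdsWithin.mono h_gt)

theorem cost_eq_eLpNorm (hq : 1 ≤ q) (P : Grid μ) (p : ℝ) (c : Set I → ℂ) :
    P.cost p q c = eLpNorm (P.levelNorm p c) q Measure.count := by
  unfold cost
  split_ifs with h
  · rw [h, eLpNorm_count_top]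
    rfl
  · simp_rw [eLpNorm_count_eq_tsum hq h, levelNorm, ← ENNReal.rpow_mul, one_div_mul_eq_div]

theorem levelNorm_le_cost (hq : 1 ≤ q) (P : Grid μ) (p : ℝ) (c : Set I → ℂ) (k : ℕ) :
    P.levelNorm p c k ≤ P.cost p q c := by
  rw [cost_eq_eLpNorm hq]
  exact enorm_le_eLpNorm_count (P.levelNorm p c) k (zero_lt_one.trans_le hq).ne'

theorem enorm_le_levelNorm (hp : 0 < p) (c : Set I → ℂ) {Q : Set I} (hQ : Q ∈ P.cells k) :
    ‖c Q‖ₑ ≤ P.levelNorm p c k := by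
  unfold levelNorm
  rw [one_div, ENNReal.le_rpow_inv_iff hp]
  exact Finset.single_le_sum (f := fun Q => ‖c Q‖ₑ ^ p) (fun _ _ => zero_le) hQ

theorem cost_le_of_enorm_le {r : ℝ≥0∞} (hp : 1 ≤ p) (hq : 1 ≤ q) (hr : 1 ≤ r)
    {c' c e : Set I → ℂ} {A : ℝ≥0∞} {X : ℕ → ℝ≥0∞}
    (h : ∀ k, ∀ Q ∈ P.cells k, ‖c' Q‖ₑ ≤ A * ‖c Q‖ₑ + X k * ‖e Q‖ₑ) :
    P.cost p q c' ≤ A * P.cost p q c + P.cost p r e * eLpNorm X q Measure.count := by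
  have h_level (k : ℕ) :
      P.levelNorm p c' k ≤ A * P.levelNorm p c k + P.cost p r e * X k := by
    refine (finset_Lp_le_of_le_add (P.cells k) hp (h k)).trans (add_le_add_right ?_ _)
    rw [mul_comm]
    gcongr
    exact levelNorm_le_cost hr P p e k
  rw [cost_eq_eLpNorm hq P p c', cost_eq_eLpNorm hq P p c, ← eLpNorm_count_const_mul hq,
    ← eLpNorm_count_const_mul hq]
  exact (eLpNorm_mono_enorm h_level).trans (eLpNorm_add_le .of_discrete .of_discrete hq)

theorem lintegral_levelMeasure (P : Grid μ) (k : ℕ) (φ : I → ℝ≥0∞) :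
    ∫⁻ x, φ x ∂P.levelMeasure k = ∑ R ∈ P.cells k, (μ R)⁻¹ * ∫⁻ x in R, φ x ∂μ := by
  simp [levelMeasure, ProbabilityTheory.cond, lintegral_finsetSum_measure,
    lintegral_smul_measure]

theorem nonempty_of_mem_cells {Q : Set I} (hQ : Q ∈ P.cells k) : Q.Nonempty :=
  nonempty_of_measure_ne_zero (P.measure_pos k Q hQ).ne'

theorem levelMeasure_le_smul (P : Grid μ) (k : ℕ) :
    P.levelMeasure k ≤ (∑ R ∈ P.cells k, (μ R)⁻¹) • μ := by
  rw [levelMeasure, Finset.sum_smul]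
  exact Finset.sum_le_sum fun R _ => by
    unfold ProbabilityTheory.cond
    gcongr
    exact Measure.restrict_le_self

theorem tendsto_eLpNorm_levelMeasure {F : ℕ → I → ℂ} (hq : q ≠ ∞)
    (hF : Tendsto (fun n => eLpNorm (F n) q μ) atTop (𝓝 0)) (k : ℕ) :
    Tendsto (fun n => eLpNorm (F n) q (P.levelMeasure k)) atTop (𝓝 0) := by
  set C := (∑ R ∈ P.cells k, (μ R)⁻¹) ^ (1 / q).toReal
  have hC : C ≠ ∞ := ENNReal.rpow_ne_top_of_nonneg ENNReal.toReal_nonneg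
    (ENNReal.sum_ne_top.2 fun R hR => ENNReal.inv_ne_top.2 (P.measure_pos k R hR).ne')
  have h_le (n : ℕ) : eLpNorm (F n) q (P.levelMeasure k) ≤ C * eLpNorm (F n) q μ := by
    rw [← smul_eq_mul, ← eLpNorm_smul_measure_of_ne_top hq]
    exact eLpNorm_mono_measure (F n) (P.levelMeasure_le_smul k)
  have h_lim := ENNReal.Tendsto.const_mul hF (.inr hC)
  rw [mul_zero] at h_lim
  exact tendsto_of_tendsto_of_tendsto_of_le_of_le tendsto_const_nhds h_lim (fun _ => zero_le) h_le

theorem cond_le_levelMeasure {R : Set I} (hR : R ∈ P.cells k) :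
    ProbabilityTheory.cond μ R ≤ P.levelMeasure k :=
  Finset.single_le_sum (f := fun R => ProbabilityTheory.cond μ R) (fun _ _ => Measure.zero_le _) hR

theorem levelMeasure_absolutelyContinuous (P : Grid μ) (k : ℕ) : P.levelMeasure k ≪ μ :=
  (Measure.absolutelyContinuous_of_le (P.levelMeasure_le_smul k)).trans
    Measure.smul_absolutelyContinuous

theorem stronglyMeasurable_block (ha : ∀ Q ∈ P.cells k, IsSouzaAtom μ s p Q (a Q)) :
    StronglyMeasurable (P.block c a k) :=
  Finset.stronglyMeasurable_fun_sum _ fun Q hQ =>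
    ((ha Q hQ).stronglyMeasurable (P.measurable_cells k Q hQ)).const_mul (c Q)

theorem stronglyMeasurable_partialSum (ha : ∀ k, ∀ Q ∈ P.cells k, IsSouzaAtom μ s p Q (a Q))
    (n : ℕ) : StronglyMeasurable (P.partialSum c a n) :=
  Finset.stronglyMeasurable_fun_sum _ fun k _ => stronglyMeasurable_block (ha k)

theorem eLpNorm_sub_partialSum_le_add (ha : ∀ k, ∀ Q ∈ P.cells k, IsSouzaAtom μ s p Q (a Q))
    {ν : Measure I} {g : I → ℂ} (hg : AEStronglyMeasurable g ν) (hq : 1 ≤ q) (k n : ℕ) :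
    eLpNorm (fun x => g x - P.partialSum c a k x) q ν ≤
      eLpNorm (fun x => g x - P.partialSum c a (k + n) x) q ν +
        ∑ i ∈ Finset.range n, eLpNorm (P.block c a (k + i)) q ν := by
  have h_split : (fun x => g x - P.partialSum c a k x) =
      (fun x => g x - P.partialSum c a (k + n) x) +
        ∑ i ∈ Finset.range n, P.block c a (k + i) := by
    ext x
    simp only [partialSum, Finset.sum_range_add, Pi.add_apply, Finset.sum_apply]
    ring
  have h_block (i : ℕ) : AEStronglyMeasurable (P.block c a (k + i)) ν :=
    (stronglyMeasurable_block (ha _)).aestronglyMeasurable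
  rw [h_split]
  exact (eLpNorm_add_le (hg.sub (stronglyMeasurable_partialSum ha _).aestronglyMeasurable)
    (Finset.aestronglyMeasurable_sum _ fun i _ => h_block i) hq).trans
      (add_le_add_right (eLpNorm_sum_le (fun i _ => h_block i) hq) _)

theorem enorm_eq_eLpNorm_cond [IsFiniteMeasure μ] {h : I → ℂ} (h_step : P.IsStep k h)
    {R : Set I} (hR : R ∈ P.cells k) {x : I} (hx : x ∈ R) (hq : q ≠ 0) :
    ‖h x‖ₑ = eLpNorm h q (ProbabilityTheory.cond μ R) := by
  have := ProbabilityTheory.cond_isProbabilityMeasure (P.measure_pos k R hR).ne'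
  rw [eLpNorm_congr_ae (g := fun _ => h x), eLpNorm_const _ hq (NeZero.ne _)]
  · simp
  · filter_upwards [ProbabilityTheory.ae_cond_mem (P.measurable_cells k R hR)] with y hy
    exact h_step R hR y hy x hx

/-- A cell belongs to one level only, so the values of the step functions of all levels can be
recorded by a single family of coefficients. -/
theorem exists_coeff_eq {h : ℕ → I → ℂ} (h_step : ∀ k, P.IsStep k (h k)) (w : Set I → ℂ) :
    ∃ c : Set I → ℂ, ∀ k, ∀ R ∈ P.cells k, ∀ x ∈ R, c R = h k x * w R := by
  suffices ∀ R : Set I, ∃ z, ∀ k, R ∈ P.cells k → ∀ x ∈ R, z = h k x * w R by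
    choose c hc using this
    exact ⟨c, fun k R => hc R k⟩
  intro R
  by_cases hR : ∃ k x, R ∈ P.cells k ∧ x ∈ R
  · obtain ⟨k, x, hk, hx⟩ := hR
    refine ⟨h k x * w R, fun j hj y hy => ?_⟩
    obtain rfl : j = k := by_contra fun hne => P.level_ne j k hne R hj R hk rfl
    rw [h_step j R hj x hx y hy]
  · exact ⟨0, fun k hk x hx => (hR ⟨k, x, hk, hx⟩).elim⟩

end Basic

variable {I : Type*} [MeasurableSpace I] {μ : Measure I} {P : Grid μ} {l : ℝ≥0}

/-- Grids whose levels are partitions up to null sets, each refining the previous one, such that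
the measure of a cell is at most `l < 1` times that of its parent. It isolates the geometric decay
of the cells of a good grid, in the form in which multipliers use it. -/
structure IsContracting (P : Grid μ) (l : ℝ≥0) : Prop where
  lt_one : l < 1
  cover : ∀ k, μ (⋃ Q ∈ P.cells k, Q)ᶜ = 0
  disjoint : ∀ k, (P.cells k : Set (Set I)).PairwiseDisjoint id
  nested : ∀ k, ∀ Q ∈ P.cells (k + 1), ∃ R ∈ P.cells k, Q ⊆ R
  measure_le : ∀ k, ∀ Q ∈ P.cells (k + 1), ∀ R ∈ P.cells k, Q ⊆ R → μ Q ≤ l * μ R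

theorem IsGood.l₂_pos {l₁ l₂ : ℝ} (hP : P.IsGood l₁ l₂) : 0 < l₂ := hP.pos.trans hP.lt

theorem IsGood.isContracting [IsFiniteMeasure μ] {l₁ : ℝ} (hP : P.IsGood l₁ l) :
    P.IsContracting l where
  lt_one := by exact_mod_cast hP.lt_one
  cover := hP.cover
  disjoint := hP.disjoint
  nested := hP.nested
  measure_le k Q hQ R hR hQR := by
    have h_pos : 0 < μ.real R :=
      ENNReal.toReal_pos (P.measure_pos k R hR).ne' (measure_ne_top μ R)
    have h_real : μ.real Q ≤ l * μ.real R := (div_le_iff₀ h_pos).1 (hP.ratio k Q hQ R hR hQR).2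
    rw [← ofReal_measureReal, ← ofReal_measureReal (s := R), ← ENNReal.ofReal_coe_nnreal,
      ← ENNReal.ofReal_mul l.coe_nonneg]
    exact ENNReal.ofReal_le_ofReal h_real

namespace IsContracting

variable {s p : ℝ} {q : ℝ≥0∞} {c : Set I → ℂ} {a : Set I → I → ℂ} {j k : ℕ} {Q R : Set I} {x : I}
  (hP : P.IsContracting l)
include hP

theorem eq_of_mem (hQ : Q ∈ P.cells k) (hR : R ∈ P.cells k) (hxQ : x ∈ Q) (hxR : x ∈ R) : Q = R :=
  (hP.disjoint k).elim_set hQ hR x hxQ hxR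

theorem sum_eq_of_mem {M : Type*} [AddCommMonoid M] (hR : R ∈ P.cells k) (hx : x ∈ R)
    (φ : Set I → M) (hφ : ∀ Q ∈ P.cells k, x ∉ Q → φ Q = 0) : ∑ Q ∈ P.cells k, φ Q = φ R :=
  Finset.sum_eq_single R
    (fun Q hQ hne => hφ Q hQ fun hxQ => hne (hP.eq_of_mem hQ hR hxQ hx)) fun h => (h hR).elim

theorem ae_mem_iUnion_cells (k : ℕ) : ∀ᵐ x ∂μ, x ∈ ⋃ Q ∈ P.cells k, Q :=
  mem_ae_iff.2 (hP.cover k)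

theorem lintegral_eq_sum_cells (k : ℕ) (φ : I → ℝ≥0∞) :
    ∫⁻ x, φ x ∂μ = ∑ R ∈ P.cells k, ∫⁻ x in R, φ x ∂μ := by
  have h_union : ∫⁻ x in ⋃ R ∈ P.cells k, R, φ x ∂μ = ∑ R ∈ P.cells k, ∫⁻ x in R, φ x ∂μ :=
    lintegral_biUnion_finset (hP.disjoint k) (P.measurable_cells k) φ
  rwa [Measure.restrict_eq_self_of_ae_mem (hP.ae_mem_iUnion_cells k)] at h_union

theorem exists_ancestor (j i : ℕ) (hQ : Q ∈ P.cells (j + i)) :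
    ∃ R ∈ P.cells j, Q ⊆ R ∧ μ Q ≤ l ^ i * μ R := by
  induction i generalizing Q with
  | zero => exact ⟨Q, hQ, subset_rfl, by simp⟩
  | succ i ih =>
    obtain ⟨S, hS, hQS⟩ := hP.nested (j + i) Q hQ
    obtain ⟨R, hR, hSR, h_le⟩ := ih hS
    refine ⟨R, hR, hQS.trans hSR, ?_⟩
    calc μ Q ≤ l * μ S := hP.measure_le _ Q hQ S hS hQS
      _ ≤ l * (l ^ i * μ R) := by gcongr
      _ = l ^ (i + 1) * μ R := by ring

theorem measure_le_pow_mul (hQ : Q ∈ P.cells k) : μ Q ≤ l ^ k * μ Set.univ := by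
  obtain ⟨R, -, -, h_le⟩ := hP.exists_ancestor 0 k (by rwa [zero_add])
  exact h_le.trans (by gcongr; exact Set.subset_univ R)

theorem levelMeasure_apply_le [IsFiniteMeasure μ] (j i : ℕ) (hQ : Q ∈ P.cells (j + i)) :
    P.levelMeasure j Q ≤ l ^ i := by
  obtain ⟨R, hR, hQR, h_le⟩ := hP.exists_ancestor j i hQ
  obtain ⟨x, hx⟩ := nonempty_of_mem_cells hQ
  have h_other (S : Set I) (hS : S ∈ P.cells j) (hxS : x ∉ S) :
      ProbabilityTheory.cond μ S Q = 0 := by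
    have h_disj : Disjoint S Q :=
      (hP.disjoint j hS hR fun h => hxS (h ▸ hQR hx)).mono_right hQR
    rw [ProbabilityTheory.cond_apply (P.measurable_cells j S hS), h_disj.inter_eq, measure_empty,
      mul_zero]
  have hR0 := (P.measure_pos j R hR).ne'
  calc P.levelMeasure j Q = (μ R)⁻¹ * μ (R ∩ Q) := by
        rw [levelMeasure, Measure.finsetSum_apply, hP.sum_eq_of_mem hR (hQR hx) _ h_other,
          ProbabilityTheory.cond_apply (P.measurable_cells j R hR)]
    _ ≤ (μ R)⁻¹ * (l ^ i * μ R) := by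
        gcongr
        exact (measure_mono Set.inter_subset_right).trans h_le
    _ = l ^ i := by
        rw [mul_left_comm, ENNReal.inv_mul_cancel hR0 (measure_ne_top μ R), mul_one]

theorem block_of_mem (ha : ∀ Q ∈ P.cells k, IsSouzaAtom μ s p Q (a Q)) (hR : R ∈ P.cells k)
    (hx : x ∈ R) : P.block c a k x = c R * a R x :=
  hP.sum_eq_of_mem hR hx (fun Q => c Q * a Q x) fun Q hQ h => by rw [(ha Q hQ).1 x h, mul_zero]

theorem isStep_block (ha : ∀ Q ∈ P.cells k, IsSouzaAtom μ s p Q (a Q)) :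
    P.IsStep k (P.block c a k) := by
  intro R hR x hx y hy
  obtain ⟨z, hz⟩ := (ha R hR).2.1
  rw [hP.block_of_mem ha hR hx, hP.block_of_mem ha hR hy, hz x hx, hz y hy]

theorem isStep_mono (hjk : j ≤ k) {h : I → ℂ} (h_step : P.IsStep j h) : P.IsStep k h := by
  obtain ⟨i, rfl⟩ := Nat.exists_eq_add_of_le hjk
  intro Q hQ x hx y hy
  obtain ⟨R, hR, hQR, -⟩ := hP.exists_ancestor j i hQ
  exact h_step R hR x (hQR hx) y (hQR hy)

theorem isStep_partialSum (ha : ∀ k, ∀ Q ∈ P.cells k, IsSouzaAtom μ s p Q (a Q)) {n : ℕ}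
    (hn : n ≤ k + 1) : P.IsStep k (P.partialSum c a n) := by
  intro R hR x hx y hy
  refine Finset.sum_congr rfl fun j hj => ?_
  have hjk : j ≤ k := by grind
  exact hP.isStep_mono hjk (hP.isStep_block (ha j)) R hR x hx y hy

theorem enorm_block_mul_le [IsFiniteMeasure μ]
    (ha : ∀ Q ∈ P.cells k, IsSouzaAtom μ s p Q (a Q)) (hR : R ∈ P.cells k) (hx : x ∈ R) :
    ‖P.block c a k x‖ₑ * μ R ^ (1 / p - s) ≤ ‖c R‖ₑ := by
  have hR0 := P.measure_pos k R hR
  calc ‖P.block c a k x‖ₑ * μ R ^ (1 / p - s)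
      ≤ ‖c R‖ₑ * (μ R ^ (s - 1 / p) * μ R ^ (1 / p - s)) := by
        rw [hP.block_of_mem ha hR hx, enorm_mul, mul_assoc]
        gcongr
        exact (ha R hR).enorm_le hR0 (measure_ne_top μ R) x
    _ = ‖c R‖ₑ := by
        rw [← ENNReal.rpow_add _ _ hR0.ne' (measure_ne_top μ R), sub_add_sub_cancel', sub_self,
          ENNReal.rpow_zero, mul_one]

theorem enorm_block_rpow_le [IsFiniteMeasure μ] (hp : 0 < p)
    (ha : ∀ Q ∈ P.cells k, IsSouzaAtom μ s p Q (a Q)) (x : I) :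
    ‖P.block c a k x‖ₑ ^ p ≤
      ∑ Q ∈ P.cells k, Q.indicator (fun _ => (‖c Q‖ₑ * μ Q ^ (s - 1 / p)) ^ p) x := by
  by_cases hx : ∃ R ∈ P.cells k, x ∈ R
  · obtain ⟨R, hR, hxR⟩ := hx
    rw [hP.sum_eq_of_mem hR hxR (fun Q => Q.indicator _ x)
      fun Q _ h => Set.indicator_of_notMem h _, Set.indicator_of_mem hxR,
      hP.block_of_mem ha hR hxR, enorm_mul]
    gcongr
    exact (ha R hR).enorm_le (P.measure_pos k R hR) (measure_ne_top μ R) x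
  · have h_zero : P.block c a k x = 0 := Finset.sum_eq_zero fun Q hQ => by
      rw [(ha Q hQ).1 x fun h => hx ⟨Q, hQ, h⟩, mul_zero]
    simp [h_zero, hp]

theorem eLpNorm_block_le [IsFiniteMeasure μ] (hp : 0 < p)
    (ha : ∀ Q ∈ P.cells k, IsSouzaAtom μ s p Q (a Q)) {ν : Measure I} {D : ℝ≥0∞}
    (hD : ∀ Q ∈ P.cells k, μ Q ^ (s - 1 / p) * ν Q ^ (1 / p) ≤ D) :
    eLpNorm (P.block c a k) (ENNReal.ofReal p) ν ≤ D * P.levelNorm p c k := by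
  rw [eLpNorm_ofReal_eq hp, levelNorm, ← finset_Lp_const_mul _ _ _ hp]
  gcongr
  calc ∫⁻ x, ‖P.block c a k x‖ₑ ^ p ∂ν
      ≤ ∫⁻ x, ∑ Q ∈ P.cells k, Q.indicator (fun _ => (‖c Q‖ₑ * μ Q ^ (s - 1 / p)) ^ p) x ∂ν :=
        lintegral_mono fun x => hP.enorm_block_rpow_le hp ha x
    _ = ∑ Q ∈ P.cells k, (‖c Q‖ₑ * μ Q ^ (s - 1 / p)) ^ p * ν Q := by
        rw [lintegral_finsetSum _ fun Q hQ =>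
          measurable_const.indicator (P.measurable_cells k Q hQ)]
        exact Finset.sum_congr rfl fun Q hQ =>
          lintegral_indicator_const (P.measurable_cells k Q hQ) _
    _ = ∑ Q ∈ P.cells k, (μ Q ^ (s - 1 / p) * ν Q ^ (1 / p) * ‖c Q‖ₑ) ^ p := by
        refine Finset.sum_congr rfl fun Q _ => ?_
        simp_rw [ENNReal.mul_rpow_of_nonneg _ _ hp.le, ← ENNReal.rpow_mul,
          one_div_mul_cancel hp.ne', ENNReal.rpow_one]
        ring
    _ ≤ ∑ Q ∈ P.cells k, (D * ‖c Q‖ₑ) ^ p := by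
        gcongr with Q hQ
        exact hD Q hQ

theorem eLpNorm_block_le_rpow [IsFiniteMeasure μ] (hp : 0 < p) (hs : 0 ≤ s)
    (ha : ∀ Q ∈ P.cells k, IsSouzaAtom μ s p Q (a Q)) :
    eLpNorm (P.block c a k) (ENNReal.ofReal p) μ ≤
      (l ^ k * μ Set.univ) ^ s * P.levelNorm p c k := by
  refine hP.eLpNorm_block_le hp ha fun Q hQ => ?_
  rw [← ENNReal.rpow_add _ _ (P.measure_pos k Q hQ).ne' (measure_ne_top μ Q), sub_add_cancel]
  gcongr
  exact hP.measure_le_pow_mul hQ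

theorem eLpNorm_block_levelMeasure_le [IsFiniteMeasure μ] (hp : 0 < p) (j i : ℕ)
    (ha : ∀ Q ∈ P.cells (j + i), IsSouzaAtom μ (1 / p) p Q (a Q)) :
    eLpNorm (P.block c a (j + i)) (ENNReal.ofReal p) (P.levelMeasure j) ≤
      ((l : ℝ≥0∞) ^ (1 / p)) ^ i * P.levelNorm p c (j + i) := by
  refine hP.eLpNorm_block_le hp ha fun Q hQ => ?_
  rw [sub_self, ENNReal.rpow_zero, one_mul, ← ENNReal.rpow_natCast, ← ENNReal.rpow_mul, mul_comm,
    ENNReal.rpow_mul, ENNReal.rpow_natCast]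
  gcongr
  exact hP.levelMeasure_apply_le j i hQ

theorem rpow_lt_one {r : ℝ} (hr : 0 < r) : (l : ℝ≥0∞) ^ r < 1 :=
  ENNReal.rpow_lt_one (by exact_mod_cast hP.lt_one) hr

theorem inv_one_sub_rpow_ne_top {r : ℝ} (hr : 0 < r) : (1 - (l : ℝ≥0∞) ^ r)⁻¹ ≠ ∞ :=
  ENNReal.inv_ne_top.2 (tsub_pos_of_lt (hP.rpow_lt_one hr)).ne'

theorem tsum_rpow_lt_top [IsFiniteMeasure μ] (hs : 0 < s) :
    ∑' k, (l ^ k * μ Set.univ) ^ s < ∞ := by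
  have h_geom (k : ℕ) : (l ^ k * μ Set.univ) ^ s = ((l : ℝ≥0∞) ^ s) ^ k * μ Set.univ ^ s := by
    rw [ENNReal.mul_rpow_of_nonneg _ _ hs.le, ← ENNReal.rpow_natCast, ← ENNReal.rpow_mul,
      mul_comm (k : ℝ), ENNReal.rpow_mul, ENNReal.rpow_natCast]
  simp_rw [h_geom, ENNReal.tsum_mul_right, ENNReal.tsum_geometric]
  exact ENNReal.mul_lt_top (hP.inv_one_sub_rpow_ne_top hs).lt_top
    (ENNReal.rpow_lt_top_of_nonneg hs.le (measure_ne_top μ _))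

theorem tsum_eLpNorm_block_lt_top [IsFiniteMeasure μ] (hp : 0 < p) (hq : 1 ≤ q) (hs : 0 < s)
    (ha : ∀ k, ∀ Q ∈ P.cells k, IsSouzaAtom μ s p Q (a Q)) (hc : P.cost p q c < ∞) :
    ∑' k, eLpNorm (P.block c a k) (ENNReal.ofReal p) μ < ∞ := by
  calc ∑' k, eLpNorm (P.block c a k) (ENNReal.ofReal p) μ
      ≤ ∑' k, (l ^ k * μ Set.univ) ^ s * P.cost p q c := by
        gcongr with k
        exact (hP.eLpNorm_block_le_rpow hp hs.le (ha k)).trans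
          (by gcongr; exact levelNorm_le_cost hq P p c k)
    _ < ∞ := by
        rw [ENNReal.tsum_mul_right]
        exact ENNReal.mul_lt_top (hP.tsum_rpow_lt_top hs) hc

theorem eLpNorm_sub_partialSum_levelMeasure_le [IsFiniteMeasure μ] {g : I → ℂ} {e : Set I → ℂ}
    {b : Set I → I → ℂ} (hp : 1 ≤ p) (hq : 1 ≤ q) (hg : P.IsRepresentation (1 / p) p q g e b)
    (hg_meas : AEStronglyMeasurable g μ) (hjk : j ≤ k) :
    eLpNorm (fun x => g x - P.partialSum e b k x) (ENNReal.ofReal p) (P.levelMeasure j) ≤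
      (1 - (l : ℝ≥0∞) ^ (1 / p))⁻¹ * P.cost p q e := by
  have hp0 : 0 < p := by linarith
  have hp1 : 1 ≤ ENNReal.ofReal p := ENNReal.one_le_ofReal.2 hp
  set θ := (l : ℝ≥0∞) ^ (1 / p)
  have hθ : θ ≤ 1 := (hP.rpow_lt_one (by positivity)).le
  have h_block (i : ℕ) : eLpNorm (P.block e b (k + i)) (ENNReal.ofReal p) (P.levelMeasure j) ≤
      θ ^ i * P.cost p q e := by
    obtain ⟨d, rfl⟩ := Nat.exists_eq_add_of_le hjk
    rw [Nat.add_assoc]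
    exact (hP.eLpNorm_block_levelMeasure_le hp0 j (d + i) (hg.atoms _)).trans
      (mul_le_mul' (pow_le_pow_right_of_le_one' hθ (Nat.le_add_left i d))
        (levelNorm_le_cost hq P p e _))
  have h_le (n : ℕ) :
      eLpNorm (fun x => g x - P.partialSum e b k x) (ENNReal.ofReal p) (P.levelMeasure j) ≤
        eLpNorm (fun x => g x - P.partialSum e b (k + n) x) (ENNReal.ofReal p)
          (P.levelMeasure j) + (1 - θ)⁻¹ * P.cost p q e := by
    refine (eLpNorm_sub_partialSum_le_add hg.atoms (hg_meas.mono_ac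
      (P.levelMeasure_absolutelyContinuous j)) hp1 k n).trans (add_le_add_right ?_ _)
    calc ∑ i ∈ Finset.range n, eLpNorm (P.block e b (k + i)) (ENNReal.ofReal p) (P.levelMeasure j)
        ≤ (∑ i ∈ Finset.range n, θ ^ i) * P.cost p q e := by
          rw [Finset.sum_mul]
          exact Finset.sum_le_sum fun i _ => h_block i
      _ ≤ (1 - θ)⁻¹ * P.cost p q e := by
          rw [← ENNReal.tsum_geometric]
          gcongr
          exact ENNReal.sum_le_tsum _
  have h_lim := ((tendsto_eLpNorm_levelMeasure (P := P) ENNReal.ofReal_ne_top hg.tendsto j).comp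
    (tendsto_atTop_mono (Nat.le_add_left · k) tendsto_id)).add_const
      ((1 - θ)⁻¹ * P.cost p q e)
  rw [zero_add] at h_lim
  exact ge_of_tendsto' h_lim h_le

theorem enorm_partialSum_mul_le [IsFiniteMeasure μ] (hp : 0 < p) (hsp : s ≤ 1 / p)
    (ha : ∀ k, ∀ Q ∈ P.cells k, IsSouzaAtom μ s p Q (a Q)) (hR : R ∈ P.cells k) (hx : x ∈ R) :
    ‖P.partialSum c a k x‖ₑ * μ R ^ (1 / p - s) ≤
      geometricConv ((l : ℝ≥0∞) ^ (1 / p - s)) (P.levelNorm p c) k := by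
  have hα : 0 ≤ 1 / p - s := by linarith
  induction k generalizing R with
  | zero => simp [partialSum]
  | succ k ih =>
    obtain ⟨Q, hQ, hRQ⟩ := hP.nested k R hR
    have h_measure : μ R ^ (1 / p - s) ≤ (l : ℝ≥0∞) ^ (1 / p - s) * μ Q ^ (1 / p - s) := by
      rw [← ENNReal.mul_rpow_of_nonneg _ _ hα]
      gcongr
      exact hP.measure_le k R hR Q hQ hRQ
    have h_succ : ‖P.partialSum c a (k + 1) x‖ₑ ≤
        ‖P.partialSum c a k x‖ₑ + ‖P.block c a k x‖ₑ := by
      rw [partialSum, Finset.sum_range_succ]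
      exact enorm_add_le _ _
    calc ‖P.partialSum c a (k + 1) x‖ₑ * μ R ^ (1 / p - s)
        ≤ (‖P.partialSum c a k x‖ₑ + ‖P.block c a k x‖ₑ) *
            ((l : ℝ≥0∞) ^ (1 / p - s) * μ Q ^ (1 / p - s)) := by gcongr
      _ = (l : ℝ≥0∞) ^ (1 / p - s) * (‖P.partialSum c a k x‖ₑ * μ Q ^ (1 / p - s) +
            ‖P.block c a k x‖ₑ * μ Q ^ (1 / p - s)) := by ring
      _ ≤ geometricConv ((l : ℝ≥0∞) ^ (1 / p - s)) (P.levelNorm p c) (k + 1) := by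
          rw [geometricConv]
          gcongr
          · exact ih hQ (hRQ hx)
          · exact (hP.enorm_block_mul_le (ha k) hQ (hRQ hx)).trans (enorm_le_levelNorm hp c hQ)

theorem eLpNorm_mul_le_levelMeasure [IsFiniteMeasure μ] (hp : 0 < p) (u : I → ℂ) {F : I → ℂ}
    {D : ℝ≥0∞} (hD : D ≠ ∞) (hF : ∀ R ∈ P.cells k, ∀ x ∈ R, ‖F x‖ₑ * μ R ^ (1 / p) ≤ D) :
    eLpNorm (fun x => u x * F x) (ENNReal.ofReal p) μ ≤
      D * eLpNorm u (ENNReal.ofReal p) (P.levelMeasure k) := by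
  rw [eLpNorm_ofReal_eq hp, eLpNorm_ofReal_eq hp]
  calc (∫⁻ x, ‖u x * F x‖ₑ ^ p ∂μ) ^ (1 / p)
      ≤ (D ^ p * ∫⁻ x, ‖u x‖ₑ ^ p ∂P.levelMeasure k) ^ (1 / p) := by
        rw [hP.lintegral_eq_sum_cells k, lintegral_levelMeasure, Finset.mul_sum]
        gcongr with R hR
        exact setLIntegral_mul_rpow_le hp (P.measurable_cells k R hR) (P.measure_pos k R hR)
          (measure_ne_top μ R) u hD (hF R hR)
    _ = D * (∫⁻ x, ‖u x‖ₑ ^ p ∂P.levelMeasure k) ^ (1 / p) := by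
        rw [ENNReal.mul_rpow_of_nonneg _ _ (by positivity), ← ENNReal.rpow_mul,
          mul_one_div_cancel hp.ne', ENNReal.rpow_one]

theorem enorm_mul_partialSum_sub_mul_le [IsFiniteMeasure μ] {e : Set I → ℂ} {b : Set I → I → ℂ}
    (hp : 0 < p) (hsp : s ≤ 1 / p) (hb : ∀ k, ∀ Q ∈ P.cells k, IsSouzaAtom μ (1 / p) p Q (b Q))
    (ha : ∀ k, ∀ Q ∈ P.cells k, IsSouzaAtom μ s p Q (a Q)) (hR : R ∈ P.cells k) (hx : x ∈ R) :
    ‖P.partialSum e b (k + 1) x * P.partialSum c a (k + 1) x -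
        P.partialSum e b k x * P.partialSum c a k x‖ₑ * μ R ^ (1 / p - s) ≤
      ‖P.partialSum e b (k + 1) x‖ₑ * ‖c R‖ₑ +
        geometricConv ((l : ℝ≥0∞) ^ (1 / p - s)) (P.levelNorm p c) k * ‖e R‖ₑ := by
  set G := P.partialSum e b
  set F := P.partialSum c a
  have h_split : G (k + 1) x * F (k + 1) x - G k x * F k x =
      G (k + 1) x * P.block c a k x + F k x * P.block e b k x := by
    have hF : F (k + 1) x = F k x + P.block c a k x := Finset.sum_range_succ _ _
    have hG : G (k + 1) x = G k x + P.block e b k x := Finset.sum_range_succ _ _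
    rw [hF, hG]
    ring
  have h_block : ‖P.block e b k x‖ₑ ≤ ‖e R‖ₑ := by
    simpa using hP.enorm_block_mul_le (hb k) hR hx
  calc ‖G (k + 1) x * F (k + 1) x - G k x * F k x‖ₑ * μ R ^ (1 / p - s)
      ≤ (‖G (k + 1) x‖ₑ * ‖P.block c a k x‖ₑ + ‖F k x‖ₑ * ‖P.block e b k x‖ₑ) *
          μ R ^ (1 / p - s) := by
        rw [h_split, ← enorm_mul, ← enorm_mul]
        gcongr
        exact enorm_add_le _ _
    _ = ‖G (k + 1) x‖ₑ * (‖P.block c a k x‖ₑ * μ R ^ (1 / p - s)) +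
          ‖F k x‖ₑ * μ R ^ (1 / p - s) * ‖P.block e b k x‖ₑ := by ring
    _ ≤ _ := by
        gcongr
        · exact hP.enorm_block_mul_le (ha k) hR hx
        · exact hP.enorm_partialSum_mul_le hp hsp ha hR hx

theorem enorm_partialSum_succ_le [IsFiniteMeasure μ] {g : I → ℂ} {e : Set I → ℂ}
    {b : Set I → I → ℂ} (hp : 1 ≤ p) (hq : 1 ≤ q) (hg : P.IsRepresentation (1 / p) p q g e b)
    (hg_meas : AEStronglyMeasurable g μ) (hR : R ∈ P.cells k) (hx : x ∈ R) :
    ‖P.partialSum e b (k + 1) x‖ₑ ≤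
      eLpNorm g ∞ μ + (1 - (l : ℝ≥0∞) ^ (1 / p))⁻¹ * P.cost p q e := by
  have hp1 : 1 ≤ ENNReal.ofReal p := ENNReal.one_le_ofReal.2 hp
  have := ProbabilityTheory.cond_isProbabilityMeasure (P.measure_pos k R hR).ne'
  set ν := ProbabilityTheory.cond μ R
  have hν : ν ≪ μ := ProbabilityTheory.cond_absolutelyContinuous
  set G := P.partialSum e b (k + 1)
  have hG : AEStronglyMeasurable G ν :=
    (stronglyMeasurable_partialSum hg.atoms _).aestronglyMeasurable
  have hg_ν : AEStronglyMeasurable g ν := hg_meas.mono_ac hν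
  calc ‖G x‖ₑ = eLpNorm (g - (g - G)) (ENNReal.ofReal p) ν := by
        rw [sub_sub_cancel]
        exact enorm_eq_eLpNorm_cond (hP.isStep_partialSum hg.atoms le_rfl) hR hx
          (zero_lt_one.trans_le hp1).ne'
    _ ≤ eLpNorm g (ENNReal.ofReal p) ν + eLpNorm (g - G) (ENNReal.ofReal p) ν :=
        eLpNorm_sub_le hg_ν (hg_ν.sub hG) hp1
    _ ≤ eLpNorm g ∞ μ + (1 - (l : ℝ≥0∞) ^ (1 / p))⁻¹ * P.cost p q e := by
        gcongr
        · refine (eLpNorm_le_eLpNorm_of_exponent_le le_top hg_ν).trans ?_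
          exact eLpNormEssSup_mono_measure g hν
        · exact (eLpNorm_mono_measure _ (cond_le_levelMeasure hR)).trans
            (hP.eLpNorm_sub_partialSum_levelMeasure_le hp hq hg hg_meas k.le_succ)

theorem exists_isRepresentation_of_isStep [IsFiniteMeasure μ] (hp : 0 < p) (hq : 1 ≤ q)
    (hs : 0 < s) {u : I → ℂ} {h : ℕ → I → ℂ} (h_step : ∀ k, P.IsStep k (h k))
    (h_tendsto : Tendsto (fun n => eLpNorm (fun x => u x - ∑ k ∈ Finset.range n, h k x)
      (ENNReal.ofReal p) μ) atTop (𝓝 0)) :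
    ∃ c a, (∀ k, ∀ R ∈ P.cells k, ∀ x ∈ R, ‖c R‖ₑ = ‖h k x‖ₑ * μ R ^ (1 / p - s)) ∧
      (P.cost p q c < ∞ → P.IsRepresentation s p q u c a) := by
  obtain ⟨c, hc⟩ := exists_coeff_eq h_step fun R => ((μ.real R ^ (1 / p - s) : ℝ) : ℂ)
  set a : Set I → I → ℂ := fun R => R.indicator fun _ => ((μ.real R ^ (s - 1 / p) : ℝ) : ℂ)
  have ha (k : ℕ) (R : Set I) (_ : R ∈ P.cells k) : IsSouzaAtom μ s p R (a R) :=
    isSouzaAtom_indicator_rpow s p R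
  have h_block (k : ℕ) : P.block c a k =ᵐ[μ] h k := by
    filter_upwards [hP.ae_mem_iUnion_cells k] with x hx
    obtain ⟨R, hR, hxR⟩ := Set.mem_iUnion₂.1 hx
    have h_pos : 0 < μ.real R :=
      ENNReal.toReal_pos (P.measure_pos k R hR).ne' (measure_ne_top μ R)
    have h_atom : a R x = ((μ.real R ^ (s - 1 / p) : ℝ) : ℂ) := Set.indicator_of_mem hxR _
    rw [hP.block_of_mem (ha k) hR hxR, hc k R hR x hxR, h_atom, mul_assoc, ← Complex.ofReal_mul,
      ← Real.rpow_add h_pos, sub_add_sub_cancel', sub_self, Real.rpow_zero, Complex.ofReal_one,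
      mul_one]
  refine ⟨c, a, fun k R hR x hx => ?_, fun h_cost =>
    ⟨ha, h_cost, hP.tsum_eLpNorm_block_lt_top hp hq hs ha h_cost, h_tendsto.congr fun n => ?_⟩⟩
  · rw [hc k R hR x hx, enorm_mul, ← ofReal_norm (Complex.ofReal _), Complex.norm_real,
      Real.norm_of_nonneg (Real.rpow_nonneg measureReal_nonneg _),
      ofReal_measureReal_rpow (P.measure_pos k R hR) (measure_ne_top μ R)]
  · refine eLpNorm_congr_ae ?_
    filter_upwards [ae_all_iff.2 h_block] with x hx
    simp only [hx]

theorem enorm_partialSum_mul_rpow_le [IsFiniteMeasure μ] (hp : 0 < p) (hq : 1 ≤ q) (hs : 0 ≤ s)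
    (hsp : s < 1 / p) (ha : ∀ k, ∀ Q ∈ P.cells k, IsSouzaAtom μ s p Q (a Q))
    (hR : R ∈ P.cells k) (hx : x ∈ R) :
    ‖P.partialSum c a k x‖ₑ * μ R ^ (1 / p) ≤
      (1 - (l : ℝ≥0∞) ^ (1 / p - s))⁻¹ * P.cost p q c * (l ^ k * μ Set.univ) ^ s := by
  set t := (l : ℝ≥0∞) ^ (1 / p - s)
  have ht : t < 1 := hP.rpow_lt_one (sub_pos.2 hsp)
  have h_conv : geometricConv t (P.levelNorm p c) k ≤ (1 - t)⁻¹ * P.cost p q c := by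
    calc geometricConv t (P.levelNorm p c) k
        ≤ eLpNorm (geometricConv t (P.levelNorm p c)) q Measure.count :=
          enorm_le_eLpNorm_count (geometricConv t (P.levelNorm p c)) k
            (zero_lt_one.trans_le hq).ne'
      _ ≤ t * (1 - t)⁻¹ * P.cost p q c := by
          rw [cost_eq_eLpNorm hq]
          exact eLpNorm_geometricConv_le hq ht _
      _ ≤ (1 - t)⁻¹ * P.cost p q c := by
          gcongr
          exact mul_le_of_le_one_left' ht.le
  calc ‖P.partialSum c a k x‖ₑ * μ R ^ (1 / p)
      = ‖P.partialSum c a k x‖ₑ * μ R ^ (1 / p - s) * μ R ^ s := by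
        rw [mul_assoc, ← ENNReal.rpow_add _ _ (P.measure_pos k R hR).ne' (measure_ne_top μ R),
          sub_add_cancel]
    _ ≤ (1 - t)⁻¹ * P.cost p q c * (l ^ k * μ Set.univ) ^ s := by
        refine mul_le_mul' ((hP.enorm_partialSum_mul_le hp hsp.le ha hR hx).trans h_conv) ?_
        gcongr
        exact hP.measure_le_pow_mul hR

theorem eLpNorm_mul_sub_le [IsFiniteMeasure μ] {f g : I → ℂ} {e : Set I → ℂ}
    {b : Set I → I → ℂ} {r : ℝ≥0∞} (hp : 1 ≤ p) (hq : 1 ≤ q) (hr : 1 ≤ r) (hs : 0 < s)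
    (hsp : s < 1 / p) (hf : P.IsRepresentation s p q f c a) (hf_meas : AEStronglyMeasurable f μ)
    (hg : P.IsRepresentation (1 / p) p r g e b) (hg_meas : AEStronglyMeasurable g μ) (n : ℕ) :
    eLpNorm (fun x => g x * f x - P.partialSum e b n x * P.partialSum c a n x)
        (ENNReal.ofReal p) μ ≤
      eLpNorm g ∞ μ * eLpNorm (fun x => f x - P.partialSum c a n x) (ENNReal.ofReal p) μ +
        (1 - (l : ℝ≥0∞) ^ (1 / p - s))⁻¹ * P.cost p q c * (l ^ n * μ Set.univ) ^ s *
          ((1 - (l : ℝ≥0∞) ^ (1 / p))⁻¹ * P.cost p r e) := by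
  have hp0 : 0 < p := by linarith
  set F := P.partialSum c a n
  set G := P.partialSum e b n
  have hF : AEStronglyMeasurable F μ :=
    (stronglyMeasurable_partialSum hf.atoms n).aestronglyMeasurable
  have hG : AEStronglyMeasurable G μ :=
    (stronglyMeasurable_partialSum hg.atoms n).aestronglyMeasurable
  set D := (1 - (l : ℝ≥0∞) ^ (1 / p - s))⁻¹ * P.cost p q c * (l ^ n * μ Set.univ) ^ s
  have hD : D ≠ ∞ := ENNReal.mul_ne_top (ENNReal.mul_ne_top
    (hP.inv_one_sub_rpow_ne_top (sub_pos.2 hsp)) hf.cost_lt_top.ne)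
    (ENNReal.ne_top_of_tsum_ne_top (hP.tsum_rpow_lt_top hs).ne n)
  have h_split : (fun x => g x * f x - G x * F x) = g • (f - F) + fun x => (g x - G x) * F x := by
    ext x
    simp only [smul_eq_mul, Pi.add_apply, Pi.mul_apply, Pi.sub_apply]
    ring
  rw [h_split]
  refine (eLpNorm_add_le (hg_meas.smul (hf_meas.sub hF)) ((hg_meas.sub hG).mul hF)
    (ENNReal.one_le_ofReal.2 hp)).trans (add_le_add ?_ ?_)
  · exact eLpNorm_smul_le_eLpNorm_top_mul_eLpNorm _ (hf_meas.sub hF) g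
  · refine (hP.eLpNorm_mul_le_levelMeasure hp0 (fun x => g x - G x) hD fun R hR x hx =>
      hP.enorm_partialSum_mul_rpow_le hp0 hq hs.le hsp hf.atoms hR hx).trans ?_
    gcongr
    exact hP.eLpNorm_sub_partialSum_levelMeasure_le hp hr hg hg_meas le_rfl

theorem tendsto_eLpNorm_mul_sub [IsFiniteMeasure μ] {f g : I → ℂ} {e : Set I → ℂ}
    {b : Set I → I → ℂ} {r : ℝ≥0∞} (hp : 1 ≤ p) (hq : 1 ≤ q) (hr : 1 ≤ r) (hs : 0 < s)
    (hsp : s < 1 / p) (hf : P.IsRepresentation s p q f c a) (hf_meas : AEStronglyMeasurable f μ)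
    (hg : P.IsRepresentation (1 / p) p r g e b) (hg_bdd : MemLp g ∞ μ) :
    Tendsto (fun n => eLpNorm (fun x => g x * f x - P.partialSum e b n x * P.partialSum c a n x)
      (ENNReal.ofReal p) μ) atTop (𝓝 0) := by
  have h_measure := ENNReal.tendsto_atTop_zero_of_tsum_ne_top (hP.tsum_rpow_lt_top (μ := μ) hs).ne
  have h_left := ENNReal.Tendsto.const_mul hf.tendsto (.inr hg_bdd.eLpNorm_ne_top)
  have h_right := ENNReal.Tendsto.mul_const (ENNReal.Tendsto.const_mul h_measure
    (.inr (ENNReal.mul_ne_top (hP.inv_one_sub_rpow_ne_top (sub_pos.2 hsp)) hf.cost_lt_top.ne)))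
    (.inr (ENNReal.mul_ne_top (hP.inv_one_sub_rpow_ne_top (hs.trans hsp)) hg.cost_lt_top.ne))
  have h_lim := h_left.add h_right
  simp only [mul_zero, zero_mul, add_zero] at h_lim
  exact tendsto_of_tendsto_of_tendsto_of_le_of_le tendsto_const_nhds h_lim (fun _ => zero_le)
    (hP.eLpNorm_mul_sub_le hp hq hr hs hsp hf hf_meas hg hg_bdd.1)

theorem isStep_mul_partialSum_sub {e : Set I → ℂ} {b : Set I → I → ℂ} {s' : ℝ}
    (hb : ∀ k, ∀ Q ∈ P.cells k, IsSouzaAtom μ s' p Q (b Q))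
    (ha : ∀ k, ∀ Q ∈ P.cells k, IsSouzaAtom μ s p Q (a Q)) (k : ℕ) :
    P.IsStep k fun x => P.partialSum e b (k + 1) x * P.partialSum c a (k + 1) x -
      P.partialSum e b k x * P.partialSum c a k x := by
  intro R hR x hx y hy
  have hF (n : ℕ) (hn : n ≤ k + 1) := hP.isStep_partialSum (c := c) ha hn R hR x hx y hy
  have hG (n : ℕ) (hn : n ≤ k + 1) := hP.isStep_partialSum (c := e) hb hn R hR x hx y hy
  simp only [hF _ le_rfl, hF _ k.le_succ, hG _ le_rfl, hG _ k.le_succ]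

theorem cost_le_of_enorm_eq_mul_partialSum_sub [IsFiniteMeasure μ] {g : I → ℂ}
    {c' e : Set I → ℂ} {b : Set I → I → ℂ} {r : ℝ≥0∞} (hp : 1 ≤ p) (hq : 1 ≤ q) (hr : 1 ≤ r)
    (hsp : s < 1 / p) (ha : ∀ k, ∀ Q ∈ P.cells k, IsSouzaAtom μ s p Q (a Q))
    (hg : P.IsRepresentation (1 / p) p r g e b) (hg_meas : AEStronglyMeasurable g μ)
    (hc' : ∀ k, ∀ R ∈ P.cells k, ∀ x ∈ R,
      ‖c' R‖ₑ = ‖P.partialSum e b (k + 1) x * P.partialSum c a (k + 1) x -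
        P.partialSum e b k x * P.partialSum c a k x‖ₑ * μ R ^ (1 / p - s)) :
    P.cost p q c' ≤ ((1 - (l : ℝ≥0∞) ^ (1 / p))⁻¹ * (1 - (l : ℝ≥0∞) ^ (1 / p - s))⁻¹ *
      P.cost p r e + eLpNorm g ∞ μ) * P.cost p q c := by
  set θ := (l : ℝ≥0∞) ^ (1 / p)
  set t := (l : ℝ≥0∞) ^ (1 / p - s)
  have ht : t < 1 := hP.rpow_lt_one (sub_pos.2 hsp)
  have h_coeff (k : ℕ) (R : Set I) (hR : R ∈ P.cells k) :
      ‖c' R‖ₑ ≤ (eLpNorm g ∞ μ + (1 - θ)⁻¹ * P.cost p r e) * ‖c R‖ₑ +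
        geometricConv t (P.levelNorm p c) k * ‖e R‖ₑ := by
    obtain ⟨x, hx⟩ := nonempty_of_mem_cells hR
    rw [hc' k R hR x hx]
    refine (hP.enorm_mul_partialSum_sub_mul_le (by linarith) hsp.le hg.atoms ha hR hx).trans ?_
    gcongr
    exact hP.enorm_partialSum_succ_le hp hr hg hg_meas hR hx
  calc P.cost p q c'
      ≤ (eLpNorm g ∞ μ + (1 - θ)⁻¹ * P.cost p r e) * P.cost p q c +
          P.cost p r e * (t * (1 - t)⁻¹ * P.cost p q c) := by
        refine (cost_le_of_enorm_le hp hq hr h_coeff).trans ?_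
        rw [cost_eq_eLpNorm hq P p c]
        gcongr
        exact eLpNorm_geometricConv_le hq ht _
    _ = (((1 - θ)⁻¹ + t * (1 - t)⁻¹) * P.cost p r e + eLpNorm g ∞ μ) * P.cost p q c := by ring
    _ ≤ ((1 - θ)⁻¹ * (1 - t)⁻¹ * P.cost p r e + eLpNorm g ∞ μ) * P.cost p q c := by
        gcongr
        exact inv_one_sub_add_le_mul θ ht

theorem exists_isRepresentation_mul [IsFiniteMeasure μ] {f g : I → ℂ} {e : Set I → ℂ}
    {b : Set I → I → ℂ} {r : ℝ≥0∞} (hp : 1 ≤ p) (hq : 1 ≤ q) (hr : 1 ≤ r) (hs : 0 < s)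
    (hsp : s < 1 / p) (hf : P.IsRepresentation s p q f c a) (hf_meas : AEStronglyMeasurable f μ)
    (hg : P.IsRepresentation (1 / p) p r g e b) (hg_bdd : MemLp g ∞ μ) :
    ∃ c' a', P.IsRepresentation s p q (fun x => g x * f x) c' a' ∧
      P.cost p q c' ≤ ((1 - (l : ℝ≥0∞) ^ (1 / p))⁻¹ * (1 - (l : ℝ≥0∞) ^ (1 / p - s))⁻¹ *
        P.cost p r e + eLpNorm g ∞ μ) * P.cost p q c := by
  set F := P.partialSum c a
  set G := P.partialSum e b
  have h_tendsto : Tendsto (fun n => eLpNorm (fun x => g x * f x - ∑ k ∈ Finset.range n,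
      (G (k + 1) x * F (k + 1) x - G k x * F k x)) (ENNReal.ofReal p) μ) atTop (𝓝 0) := by
    refine (hP.tendsto_eLpNorm_mul_sub hp hq hr hs hsp hf hf_meas hg hg_bdd).congr fun n => ?_
    congr 1
    ext x
    rw [Finset.sum_range_sub fun k => G k x * F k x]
    simp [F, G, partialSum]
  obtain ⟨c', a', hc', h_rep⟩ := hP.exists_isRepresentation_of_isStep (by linarith) hq hs
    (hP.isStep_mul_partialSum_sub hg.atoms hf.atoms) h_tendsto
  have h_cost := hP.cost_le_of_enorm_eq_mul_partialSum_sub hp hq hr hsp hf.atoms hg hg_bdd.1 hc'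
  have h_const : (1 - (l : ℝ≥0∞) ^ (1 / p))⁻¹ * (1 - (l : ℝ≥0∞) ^ (1 / p - s))⁻¹ *
      P.cost p r e ≠ ∞ :=
    ENNReal.mul_ne_top (ENNReal.mul_ne_top (hP.inv_one_sub_rpow_ne_top (hs.trans hsp))
      (hP.inv_one_sub_rpow_ne_top (sub_pos.2 hsp))) hg.cost_lt_top.ne
  exact ⟨c', a', h_rep (h_cost.trans_lt (ENNReal.mul_lt_top
    (ENNReal.add_lt_top.2 ⟨h_const.lt_top, hg_bdd.2⟩) hf.cost_lt_top)), h_cost⟩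

theorem memBesov_mul [IsFiniteMeasure μ] {f g : I → ℂ} {r : ℝ≥0∞} (hp : 1 ≤ p) (hq : 1 ≤ q)
    (hr : 1 ≤ r) (hs : 0 < s) (hsp : s < 1 / p) (hg : P.MemBesov (1 / p) p r g)
    (hg_bdd : MemLp g ∞ μ) (hf : P.MemBesov s p q f) :
    P.MemBesov s p q fun x => g x * f x := by
  obtain ⟨-, e, b, hg_rep⟩ := hg
  obtain ⟨hf_Lp, c, a, hf_rep⟩ := hf
  obtain ⟨c', a', h_rep, -⟩ :=
    hP.exists_isRepresentation_mul hp hq hr hs hsp hf_rep hf_Lp.1 hg_rep hg_bdd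
  exact ⟨hf_Lp.mul hg_bdd, c', a', h_rep⟩

theorem besovENorm_mul_le [IsFiniteMeasure μ] {f g : I → ℂ} {r : ℝ≥0∞} (hp : 1 ≤ p) (hq : 1 ≤ q)
    (hr : 1 ≤ r) (hs : 0 < s) (hsp : s < 1 / p) (hg : P.MemBesov (1 / p) p r g)
    (hg_bdd : MemLp g ∞ μ) (hf : P.MemBesov s p q f) :
    P.besovENorm s p q (fun x => g x * f x) ≤
      ((1 - (l : ℝ≥0∞) ^ (1 / p))⁻¹ * (1 - (l : ℝ≥0∞) ^ (1 / p - s))⁻¹ *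
        P.besovENorm (1 / p) p r g + eLpNorm g ∞ μ) * P.besovENorm s p q f := by
  set κ := (1 - (l : ℝ≥0∞) ^ (1 / p))⁻¹ * (1 - (l : ℝ≥0∞) ^ (1 / p - s))⁻¹
  have hκ : κ ≠ ∞ := ENNReal.mul_ne_top (hP.inv_one_sub_rpow_ne_top (hs.trans hsp))
    (hP.inv_one_sub_rpow_ne_top (sub_pos.2 hsp))
  refine hg.le_map_besovENorm
    (φ := fun y => (κ * y + eLpNorm g ∞ μ) * P.besovENorm s p q f) ?_ ?_ fun e b hg_rep => ?_
  · exact (ENNReal.continuous_mul_const hf.besovENorm_ne_top).comp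
      ((ENNReal.continuous_const_mul hκ).add continuous_const)
  · intro y z hyz
    dsimp only
    gcongr
  refine hf.le_map_besovENorm (φ := fun y => (κ * P.cost p r e + eLpNorm g ∞ μ) * y) ?_ ?_
    fun c a hf_rep => ?_
  · exact ENNReal.continuous_const_mul (ENNReal.add_ne_top.2
      ⟨ENNReal.mul_ne_top hκ hg_rep.cost_lt_top.ne, hg_bdd.eLpNorm_ne_top⟩)
  · exact fun y z hyz => mul_le_mul_right hyz _
  · obtain ⟨c', a', h_rep, h_cost⟩ :=
      hP.exists_isRepresentation_mul hp hq hr hs hsp hf_rep hf.1.1 hg_rep hg_bdd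
    exact h_rep.besovENorm_le_cost.trans h_cost

theorem one_sub_rpow_pos {r : ℝ} (hr : 0 < r) : 0 < 1 - (l : ℝ) ^ r :=
  sub_pos.2 (Real.rpow_lt_one l.coe_nonneg (by exact_mod_cast hP.lt_one) hr)

theorem toReal_inv_one_sub_rpow {r : ℝ} (hr : 0 < r) :
    ((1 - (l : ℝ≥0∞) ^ r)⁻¹).toReal = (1 - (l : ℝ) ^ r)⁻¹ := by
  rw [ENNReal.toReal_inv, ENNReal.toReal_sub_of_le (hP.rpow_lt_one hr).le ENNReal.one_ne_top,
    ENNReal.toReal_one, ← ENNReal.toReal_rpow, ENNReal.coe_toReal]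

theorem besovNorm_mul_le [IsFiniteMeasure μ] {f g : I → ℂ} {r : ℝ≥0∞} (hp : 1 ≤ p) (hq : 1 ≤ q)
    (hr : 1 ≤ r) (hs : 0 < s) (hsp : s < 1 / p) (hg : P.MemBesov (1 / p) p r g)
    (hg_bdd : MemLp g ∞ μ) (hf : P.MemBesov s p q f) :
    P.besovNorm s p q (fun x => g x * f x) ≤
      (1 / (1 - (l : ℝ) ^ (1 / p)) * (P.besovNorm (1 / p) p r g / (1 - (l : ℝ) ^ (1 / p - s))) +
        (eLpNorm g ∞ μ).toReal) * P.besovNorm s p q f := by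
  have hκ := ENNReal.mul_ne_top (hP.inv_one_sub_rpow_ne_top (hs.trans hsp))
    (hP.inv_one_sub_rpow_ne_top (sub_pos.2 hsp))
  have h_le := ENNReal.toReal_mono
    (ENNReal.mul_ne_top (ENNReal.add_ne_top.2
      ⟨ENNReal.mul_ne_top hκ hg.besovENorm_ne_top, hg_bdd.eLpNorm_ne_top⟩) hf.besovENorm_ne_top)
    (hP.besovENorm_mul_le hp hq hr hs hsp hg hg_bdd hf)
  rw [ENNReal.toReal_mul, ENNReal.toReal_add (ENNReal.mul_ne_top hκ hg.besovENorm_ne_top)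
    hg_bdd.eLpNorm_ne_top, ENNReal.toReal_mul, ENNReal.toReal_mul,
    hP.toReal_inv_one_sub_rpow (hs.trans hsp), hP.toReal_inv_one_sub_rpow (sub_pos.2 hsp)] at h_le
  rwa [one_div (1 - _), div_eq_inv_mul (P.besovNorm _ _ _ _), ← mul_assoc]

end IsContracting

theorem multiplierNorm_le {s p K : ℝ} {q : ℝ≥0∞} {g : I → ℂ} (hK : 0 ≤ K)
    (h : ∀ f, P.MemBesov s p q f →
      P.besovNorm s p q (fun x => g x * f x) ≤ K * P.besovNorm s p q f) :
    P.multiplierNorm s p q g ≤ K := by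
  refine Real.sSup_le ?_ hK
  rintro _ ⟨f, hf, hf_le, rfl⟩
  exact (h f hf).trans (mul_le_of_le_one_right hK hf_le)

theorem IsGood.one_div_one_sub_rpow_le {s : ℝ} {l₁ l₂ : ℝ} (hP : P.IsGood l₁ l₂) (hs : 0 < s)
    (p : ℝ) (q : ℝ≥0∞) :
    1 / (1 - l₂ ^ s) ≤ standardConst l₁ l₂ s p * oscConst P l₂ s p q := by
  have hl₁ := hP.pos
  have hl₂ := hP.l₂_pos
  have h_mesh (k : ℕ) : 0 ≤ P.mesh k := Real.iSup_nonneg fun _ => measureReal_nonneg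
  have h_holder : 0 ≤ holderConst p q fun k => P.mesh k ^ (s * p) := by
    unfold holderConst
    split_ifs
    · exact Real.iSup_nonneg fun k => by have := h_mesh k; positivity
    · exact Real.rpow_nonneg (tsum_nonneg fun k => by have := h_mesh k; positivity) _
  have h_standard : 1 ≤ standardConst l₁ l₂ s p := by
    unfold standardConst haarConst
    exact le_add_of_nonneg_right (by positivity)
  have h_osc : 1 / (1 - l₂ ^ s) ≤ oscConst P l₂ s p q := by
    unfold oscConst
    exact le_add_of_nonneg_left (by positivity)
  have h_pos : 0 ≤ 1 / (1 - l₂ ^ s) :=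
    one_div_nonneg.2 (sub_pos.2 (Real.rpow_lt_one hl₂.le hP.lt_one hs)).le
  exact h_osc.trans (le_mul_of_one_le_left (h_pos.trans h_osc) h_standard)

end Grid

end

theorem proposition16p6_general {I : Type*} [MeasurableSpace I] (μ : Measure I)
    [IsFiniteMeasure μ] (P : Grid μ) (l : ℝ≥0) (hP : P.IsContracting l)
    (s p : ℝ) (q : ℝ≥0∞) (hp : 1 ≤ p) (hq : 1 ≤ q) (hs : 0 < s) (hsp : s < 1 / p)
    (g : I → ℂ) (hg : P.MemBesov (1 / p) p ∞ g) (hg_bdd : MemLp g ∞ μ)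
    (K : ℝ) (hK : 1 / (1 - (l : ℝ) ^ (1 / p)) *
      (P.besovNorm (1 / p) p ∞ g / (1 - (l : ℝ) ^ (1 / p - s))) + (eLpNorm g ∞ μ).toReal ≤ K) :
    (∀ f : I → ℂ, P.MemBesov s p q f →
      P.MemBesov s p q (fun x => g x * f x) ∧
        P.besovNorm s p q (fun x => g x * f x) ≤ K * P.besovNorm s p q f) ∧
      P.multiplierNorm s p q g ≤ K := by
  have h_le (f : I → ℂ) (hf : P.MemBesov s p q f) :
      P.besovNorm s p q (fun x => g x * f x) ≤ K * P.besovNorm s p q f := by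
    refine (hP.besovNorm_mul_le hp hq le_top hs hsp hg hg_bdd hf).trans ?_
    exact mul_le_mul_of_nonneg_right hK ENNReal.toReal_nonneg
  have hK0 : 0 ≤ K := by
    have h₁ := hP.one_sub_rpow_pos (hs.trans hsp)
    have h₂ := hP.one_sub_rpow_pos (sub_pos.2 hsp)
    have h_norm : 0 ≤ P.besovNorm (1 / p) p ∞ g := ENNReal.toReal_nonneg
    exact le_trans (by positivity) hK
  exact ⟨fun f hf => ⟨hP.memBesov_mul hp hq le_top hs hsp hg hg_bdd hf, h_le f hf⟩,
    Grid.multiplierNorm_le hK0 h_le⟩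

theorem proposition16p6 {I : Type*} [MeasurableSpace I] (μ : Measure I) [IsFiniteMeasure μ]
    (P : Grid μ) (l₁ l₂ : ℝ) (hP : P.IsGood l₁ l₂)
    (s p : ℝ) (q : ℝ≥0∞) (hp : 1 ≤ p) (hq : 1 ≤ q) (hs : 0 < s) (hsp : s < 1 / p)
    (g : I → ℂ) (hg : P.MemBesov (1 / p) p ∞ g) (hg_bdd : MemLp g ∞ μ)
    (K : ℝ) (hK : K = standardConst l₁ l₂ (1 / p) p * oscConst P l₂ (1 / p) p ∞ *
        (P.besovNorm (1 / p) p ∞ g / (1 - l₂ ^ (1 / p - s))) + (eLpNorm g ∞ μ).toReal) :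
    (∀ f : I → ℂ, P.MemBesov s p q f →
      P.MemBesov s p q (fun x => g x * f x) ∧
        P.besovNorm s p q (fun x => g x * f x) ≤ K * P.besovNorm s p q f) ∧
      P.multiplierNorm s p q g ≤ K := by
  lift l₂ to ℝ≥0 using hP.l₂_pos.le
  have h_const := hP.one_div_one_sub_rpow_le (hs.trans hsp) p ∞
  have h_norm : 0 ≤ P.besovNorm (1 / p) p ∞ g / (1 - l₂ ^ (1 / p - s)) :=
    div_nonneg ENNReal.toReal_nonneg (hP.isContracting.one_sub_rpow_pos (sub_pos.2 hsp)).le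
  exact proposition16p6_general μ P l₂ hP.isContracting s p q hp hq hs hsp g hg hg_bdd K
    (hK ▸ add_le_add_left (mul_le_mul_of_nonneg_right h_const h_norm) _)
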